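/- All digraphs are finite, without loops and without multiple arcs. A digraph is balanced bipartite if its vertex set is the disjoint union of two independent sets of equal cardinality; it is strong if for any two vertices $x,y$ there is a directed path from $x$ to $y$; it is hamiltonian if it has a directed cycle through all of its vertices. The degree of $v$ is $d(v)=d^+(v)+d^-(v)$, the sum of its out-degree and in-degree. A pair $\{x,y\}$ of distinct vertices is dominating if there is a vertex $z$ with $x\to z$ and $y\to z$. Theorem. Let $D$ be a strong balanced bipartite digraph on $2a$ vertices, where $a\ge 2$. Suppose that $D$ satisfies condition $B_1$: for every dominating pair $\{x,y\}$ of $D$, either $d(x)\ge 2a-1$ and $d(y)\ge a+1$, or $d(y)\ge 2a-1$ and $d(x)\ge a+1$. Then $D$ is hamiltonian. The bounds are sharp in the following sense. For each $a\in\{2,3\}$ there is a non-hamiltonian strong balanced bipartite digraph on $2a$ vertices such that for every dominating pair $\{x,y\}$ one of its vertices has degree at least $2a-2$ and the other one has degree at least $a+1$; and for each $a\in\{2,3\}$ there is a non-hamiltonian strong balanced bipartite digraph on $2a$ vertices such that for every dominating pair $\{x,y\}$ one of its vertices has degree at least $2a-1$ and the other one has degree at least $a$. -/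

import Mathlib

namespace Digraph

variable {V : Type*}

/-- No arc of `D` joins two vertices of `S`; in particular no vertex of `S` carries a loop. -/
def IsIndependent (D : Digraph V) (S : Set V) : Prop :=
  ∀ u ∈ S, ∀ v ∈ S, ¬ D.Adj u v

/-- The vertex set is the disjoint union of two independent sets of the same size.
Such a digraph has no loops, and a `Digraph` never has multiple arcs. -/
def IsBalancedBipartite (D : Digraph V) : Prop :=
  ∃ V₁ V₂ : Set V, Disjoint V₁ V₂ ∧ V₁ ∪ V₂ = Set.univ ∧
    D.IsIndependent V₁ ∧ D.IsIndependent V₂ ∧ V₁.ncard = V₂.ncard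

/-- Every vertex can be reached from every vertex along arcs. -/
def IsStrong (D : Digraph V) : Prop :=
  ∀ x y : V, Relation.ReflTransGen D.Adj x y

/-- `d⁺(v)`, the number of vertices dominated by `v`. -/
noncomputable def outDeg (D : Digraph V) (v : V) : ℕ := {u | D.Adj v u}.ncard

/-- `d⁻(v)`, the number of vertices dominating `v`. -/
noncomputable def inDeg (D : Digraph V) (v : V) : ℕ := {u | D.Adj u v}.ncard

/-- `d(v) = d⁺(v) + d⁻(v)`. -/
noncomputable def deg (D : Digraph V) (v : V) : ℕ := D.outDeg v + D.inDeg v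

/-- `{x, y}` is a dominating pair: two distinct vertices that dominate a common vertex. -/
def IsDominatingPair (D : Digraph V) (x y : V) : Prop :=
  x ≠ y ∧ ∃ z, D.Adj x z ∧ D.Adj y z

/-- In every dominating pair one vertex has degree at least `p`
and the other one has degree at least `q`. -/
def DominatingPairDegrees (D : Digraph V) (p q : ℕ) : Prop :=
  ∀ x y, D.IsDominatingPair x y →
    (p ≤ D.deg x ∧ q ≤ D.deg y) ∨ (p ≤ D.deg y ∧ q ≤ D.deg x)

/-- Condition `B_k` for a digraph on `2a` vertices. (The truncated subtraction is harmless: a lower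
bound on a degree by a negative number and by `0` both always hold.) -/
def ConditionB (D : Digraph V) (a k : ℕ) : Prop :=
  D.DominatingPairDegrees (2 * a - k) (a + k)

/-- A directed cycle: a cyclic sequence of at least two vertices, without repetitions, with
an arc from each vertex to the next one (cyclically). -/
def IsDicycle (D : Digraph V) (c : Cycle V) : Prop :=
  c.Nontrivial ∧ c.Nodup ∧ c.Chain D.Adj

/-- `D` has a directed cycle that includes every vertex. -/
def IsHamiltonian (D : Digraph V) : Prop :=
  ∃ c : Cycle V, D.IsDicycle c ∧ ∀ v, v ∈ c

end Digraph

/-! A cycle factor is a permutation `σ` with an arc from each `v` to `σ v`; a hamiltonian cycle is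
one with a single orbit. Call a vertex large if its degree is at least `2a - 1`: it misses at most
one of the `2a` arcs that the bipartition allows, while two non-large vertices never dominate a
common vertex. Hall's theorem then yields a cycle factor (`exists_cycle_factor`).

If `x` and `u` lie on different cycles and `x → σ u`, `u → σ x`, exchanging their successors merges
the two cycles. A factor with the most pairs of vertices on a common cycle admits no such exchange
(`exists_unmergeable`). Suppose that it still has several cycles. A degree count shows that what
lies off a cycle is never just one cycle of length two (`not_isTwoCycleComplement`), so each cycle
leaves two vertices of each colour outside, and `a ≥ 3`. Then the successor of a large vertex is not
large (`not_isLarge_apply`), and each colour has at most one non-large vertex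
(`not_two_not_isLarge`). Hence there are at most two non-large vertices and no more large ones than
that, so `2a ≤ 4`, a contradiction.

Sharpness is witnessed by explicit digraphs on four and six vertices. -/

namespace Digraph

open Equiv Equiv.Perm

/-! ### Merging the cycles of a permutation -/

section General

variable {V : Type*} {D : Digraph V}

theorem IsStrong.exists_adj_leaving (h : D.IsStrong) {S : Set V} {x y : V} (hx : x ∈ S)
    (hy : y ∉ S) : ∃ p ∈ S, ∃ q ∉ S, D.Adj p q := by
  by_contra! hcon
  have : ∀ z, Relation.ReflTransGen D.Adj x z → z ∈ S := by
    intro z hz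
    induction hz with
    | refl => exact hx
    | tail _ hbc ih =>
      by_contra hc
      exact hcon _ ih _ hc hbc
  exact hy (this y (h x y))

variable [Finite V]

theorem sameCycle_induction {σ : Perm V} {P : V → Prop} (hP : ∀ v, P v → P (σ v)) {x y : V}
    (hx : P x) (h : σ.SameCycle x y) : P y := by
  obtain ⟨n, rfl⟩ := h.exists_nat_pow_eq
  clear h
  induction n with
  | zero => simpa
  | succ n ih =>
    rw [pow_succ']
    exact hP _ ih

/-- The new permutation sends `x` to `σ u` and then follows the old cycle of `u` until it arrives at
`u`, so it joins `x` to `u`; elsewhere it agrees with `σ`. -/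
theorem sameCycle_mul_swap [DecidableEq V] {σ : Perm V} {x u : V} (h : ¬ σ.SameCycle x u) :
    (∀ v w, σ.SameCycle v w → (σ * swap x u).SameCycle v w) ∧ (σ * swap x u).SameCycle x u := by
  set τ := σ * swap x u with hτ
  have hx : τ x = σ u := by simp [hτ]
  have hu : τ u = σ x := by simp [hτ]
  have hne : ∀ w, w ≠ x → w ≠ u → τ w = σ w := by
    intro w h1 h2
    simp [hτ, swap_apply_of_ne_of_ne h1 h2]
  have key : τ.SameCycle x u := by
    have : σ.SameCycle x u ∨ τ.SameCycle x u := by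
      have hind : ∀ w, σ.SameCycle (σ u) w → (σ.SameCycle u w ∧ τ.SameCycle x w) := by
        intro w hw
        refine sameCycle_induction (P := fun w => σ.SameCycle u w ∧ τ.SameCycle x w) ?_ ?_ hw
        · rintro v ⟨h1, h2⟩
          refine ⟨sameCycle_apply_right.2 h1, ?_⟩
          by_cases hvu : v = u
          · rw [hvu, ← hx]
            exact sameCycle_apply_right.2 (SameCycle.refl _ _)
          · rw [← hne v (fun hvx => h (hvx ▸ h1.symm)) hvu]
            exact sameCycle_apply_right.2 h2
        · refine ⟨sameCycle_apply_right.2 (SameCycle.refl _ _), ?_⟩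
          rw [← hx]
          exact sameCycle_apply_right.2 (SameCycle.refl _ _)
      exact Or.inr (hind u (sameCycle_apply_left.2 (SameCycle.refl _ _))).2
    exact this.resolve_left h
  refine ⟨fun v w hvw => ?_, key⟩
  refine sameCycle_induction (P := fun w => τ.SameCycle v w) ?_ (SameCycle.refl _ _) hvw
  intro z hz
  by_cases hzx : z = x
  · rw [hzx, ← hu]
    exact sameCycle_apply_right.2 ((hzx ▸ hz).trans key)
  by_cases hzu : z = u
  · rw [hzu, ← hx]
    exact sameCycle_apply_right.2 ((hzu ▸ hz).trans key.symm)
  rw [← hne z hzx hzu]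
  exact sameCycle_apply_right.2 hz

theorem exists_unmergeable (hσ : ∃ σ : Perm V, ∀ v, D.Adj v (σ v)) :
    ∃ σ : Perm V, (∀ v, D.Adj v (σ v)) ∧
      ∀ x u, ¬ σ.SameCycle x u → ¬ (D.Adj x (σ u) ∧ D.Adj u (σ x)) := by
  classical
  obtain ⟨σ, hσ, hmax⟩ := Set.exists_max_image {σ : Perm V | ∀ v, D.Adj v (σ v)}
    (fun σ => {p : V × V | σ.SameCycle p.1 p.2}.ncard) (Set.toFinite _) hσ
  refine ⟨σ, hσ, fun x u hxu ⟨h1, h2⟩ => ?_⟩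
  obtain ⟨hle, hnew⟩ := sameCycle_mul_swap hxu
  refine absurd (hmax (σ * swap x u) ?_) (not_le.2 (Set.ncard_lt_ncard ?_ (Set.toFinite _)))
  · intro v
    by_cases hvx : v = x
    · subst hvx; simpa using h1
    by_cases hvu : v = u
    · subst hvu; simpa using h2
    simpa [swap_apply_of_ne_of_ne hvx hvu] using hσ v
  · refine ⟨fun p hp => hle _ _ hp, fun hsub => hxu ?_⟩
    exact hsub (show (x, u) ∈ {p : V × V | (σ * swap x u).SameCycle p.1 p.2} from hnew)

end General

/-! ### Hamiltonian cycles as permutations with one orbit -/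

section Hamiltonian

variable {V : Type*} {D : Digraph V} [Finite V]

theorem isHamiltonian_of_sameCycle {σ : Perm V} (hσ : ∀ v, D.Adj v (σ v)) (x : V)
    (hx : σ x ≠ x) (h : ∀ v, σ.SameCycle x v) : D.IsHamiltonian := by
  classical
  have := Fintype.ofFinite V
  have hsupp : x ∈ σ.support := mem_support.2 hx
  refine ⟨(σ.toList x : Cycle V), ⟨?_, ?_, ?_⟩, ?_⟩
  · rw [Cycle.nontrivial_coe_nodup_iff (nodup_toList _ _)]
    exact two_le_length_toList_iff_mem_support.2 hsupp
  · exact nodup_toList _ _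
  · obtain ⟨n, hn⟩ : ∃ n, (σ.cycleOf x).support.card = n + 1 :=
      Nat.exists_eq_succ_of_ne_zero (by
        have := two_le_length_toList_iff_mem_support.2 hsupp
        rw [length_toList] at this
        omega)
    have hpow : (σ ^ (n + 1)) x = x := by
      have h1 := (isCycle_cycleOf σ hx).orderOf
      rw [← cycleOf_pow_apply_self, ← hn, ← h1, pow_orderOf_eq_one]
      rfl
    have hl : σ.toList x = x :: List.iterate σ (σ x) n := by
      rw [toList, hn, List.iterate]
    rw [hl, Cycle.chain_coe_cons]
    -- The closing `x` is the iterate of order `n + 1`, the length of the cycle, so the whole closed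
    -- walk is a list of iterates.
    have hl' : x :: (List.iterate σ (σ x) n ++ [x]) = List.iterate σ x (n + 2) := by
      refine List.ext_getElem (by simp) fun i h1 h2 => ?_
      rcases i with _ | i
      · simp
      · simp only [List.getElem_cons_succ, List.getElem_iterate, List.length_iterate,
          List.getElem_append]
        split_ifs with hi
        · simp [Function.iterate_succ_apply]
        · have : i = n := by simp at h2; omega
          subst this
          simp only [List.getElem_singleton]
          rw [iterate_eq_pow, hpow]
    rw [hl', List.isChain_iff_getElem]
    intro i hi
    simp only [List.getElem_iterate, Function.iterate_succ_apply']
    exact hσ _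
  · intro v
    rw [Cycle.mem_coe_iff, mem_toList_iff]
    exact ⟨h v, hsupp⟩

theorem IsHamiltonian.exists_perm (h : D.IsHamiltonian) :
    ∃ σ : Perm V, (∀ v, D.Adj v (σ v)) ∧ ∀ x y, σ.SameCycle x y := by
  classical
  have := Fintype.ofFinite V
  obtain ⟨c, ⟨hnt, hnd, hch⟩, hmem⟩ := h
  refine ⟨c.formPerm hnd, fun v => ?_, fun x y => ?_⟩
  · rw [Cycle.formPerm_apply_mem_eq_next c hnd v (hmem v)]
    have hv := hmem v
    change D.Adj v (c.next hnd v hv)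
    clear hmem
    induction c using Cycle.induction_on with
    | nil => simp at hv
    | cons b l _ =>
      rw [Cycle.chain_coe_cons, List.isChain_iff_getElem] at hch
      change D.Adj v (List.next (b :: l) v hv)
      obtain ⟨i, hi, rfl⟩ := List.getElem_of_mem (Cycle.mem_coe_iff.1 hv)
      rw [List.next_getElem _ hnd]
      have h1 := hch i (by simp at hi ⊢; omega)
      have e : b :: (l ++ [b]) = (b :: l) ++ [b] := rfl
      simp only [e] at h1
      rw [List.getElem_append_left hi] at h1
      by_cases hlast : i + 1 < (b :: l).length
      · rw [List.getElem_append_left hlast] at h1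
        simpa only [Nat.mod_eq_of_lt hlast] using h1
      · have : i + 1 = (b :: l).length := by omega
        rw [List.getElem_append_right (by omega)] at h1
        simp only [this, Nat.mod_self]
        simpa using h1
  · have hc := Cycle.isCycle_formPerm c hnd hnt
    have hs := Cycle.support_formPerm c hnd hnt
    have hmem' : ∀ v, v ∈ c.toFinset := by
      intro v
      have hv := hmem v
      clear hmem hs hc hch hnt hnd
      induction c using Quotient.inductionOn with
      | h l => exact List.mem_toFinset.2 hv
    refine hc.sameCycle ?_ ?_ <;> rw [← mem_support, hs] <;> exact hmem' _

end Hamiltonian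

end Digraph

/-! ### The degree condition and the existence of a cycle factor -/

namespace Digraph

open Equiv Equiv.Perm

/-- A digraph satisfying the degree condition, with its bipartition given by a colouring. -/
structure IsColoredB (D : Digraph V) (c : V → Bool) (a : ℕ) : Prop where
  color : ∀ u v, D.Adj u v → c v = !c u
  card : ∀ b, {v | c v = b}.ncard = a
  two_le : 2 ≤ a
  dom : D.ConditionB a 1
  strong : D.IsStrong

/-- A vertex of degree at least `2a - 1`. -/
def IsLarge (D : Digraph V) (a : ℕ) (v : V) : Prop := 2 * a - 1 ≤ D.deg v

namespace IsColoredB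

variable {V : Type*} {D : Digraph V} {c : V → Bool} {a : ℕ}

/-- As `a ≥ 2`, the larger bound `2a - 1` is at least `a + 1`. -/
theorem of_dominate (h : D.IsColoredB c a) {x y z : V} (hxy : x ≠ y) (hx : D.Adj x z)
    (hy : D.Adj y z) :
    (D.IsLarge a x ∨ D.IsLarge a y) ∧ a + 1 ≤ D.deg x ∧ a + 1 ≤ D.deg y := by
  have h2 := h.two_le
  have := h.dom x y ⟨hxy, z, hx, hy⟩
  unfold IsLarge
  omega

theorem exists_ne (h : D.IsColoredB c a) (v : V) : ∃ w, c w = c v ∧ w ≠ v := by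
  obtain ⟨w, hw, hne⟩ := Set.exists_ne_of_one_lt_ncard
    (s := {w | c w = c v}) (by rw [h.card]; exact h.two_le) v
  exact ⟨w, hw, hne⟩

theorem exists_adj_to (h : D.IsColoredB c a) (v : V) : ∃ w, D.Adj w v := by
  obtain ⟨w, -, hw⟩ := h.exists_ne v
  obtain heq | ⟨u, -, hu⟩ := (h.strong w v).cases_tail
  · exact absurd heq.symm hw
  · exact ⟨u, hu⟩

theorem exists_adj_from (h : D.IsColoredB c a) (v : V) : ∃ w, D.Adj v w := by
  obtain ⟨w, -, hw⟩ := h.exists_ne v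
  obtain heq | ⟨u, hu, -⟩ := (h.strong v w).cases_head
  · exact absurd heq.symm hw
  · exact ⟨u, hu⟩

variable [Finite V]

theorem outDeg_add_le (h : D.IsColoredB c a) (v : V) (S : Set V)
    (hS : ∀ w ∈ S, c w = !c v ∧ ¬ D.Adj v w) : D.outDeg v + S.ncard ≤ a := by
  unfold outDeg
  rw [← Set.ncard_union_eq (s := {u | D.Adj v u}) (Set.disjoint_left.2 fun w hw hwS => (hS w hwS).2 hw)
    (Set.toFinite _) (Set.toFinite _), ← h.card (!c v)]
  refine Set.ncard_le_ncard ?_ (Set.toFinite _)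
  rintro w (hw | hw)
  · exact h.color _ _ hw
  · exact (hS w hw).1

theorem inDeg_add_le (h : D.IsColoredB c a) (v : V) (S : Set V)
    (hS : ∀ w ∈ S, c w = !c v ∧ ¬ D.Adj w v) : D.inDeg v + S.ncard ≤ a := by
  unfold inDeg
  rw [← Set.ncard_union_eq (s := {u | D.Adj u v}) (Set.disjoint_left.2 fun w hw hwS => (hS w hwS).2 hw)
    (Set.toFinite _) (Set.toFinite _), ← h.card (!c v)]
  refine Set.ncard_le_ncard ?_ (Set.toFinite _)
  rintro w (hw | hw)
  · have := h.color _ _ hw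
    simp [this]
  · exact (hS w hw).1

theorem outDeg_le (h : D.IsColoredB c a) (v : V) : D.outDeg v ≤ a := by
  simpa using h.outDeg_add_le v ∅ (by simp)

theorem inDeg_le (h : D.IsColoredB c a) (v : V) : D.inDeg v ≤ a := by
  simpa using h.inDeg_add_le v ∅ (by simp)

/-- A large vertex cannot miss two of its `2a` possible arcs; this lemma and the next two treat two
out-arcs, two in-arcs and one of each. -/
theorem adj_or_adj_of_out (h : D.IsColoredB c a) {v w w' : V} (hv : D.IsLarge a v)
    (hw : c w = !c v) (hw' : c w' = !c v) (hne : w ≠ w') : D.Adj v w ∨ D.Adj v w' := by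
  by_contra! hcon
  have h1 := h.outDeg_add_le v {w, w'} (by rintro _ (rfl | rfl) <;> grind)
  rw [Set.ncard_pair hne] at h1
  have h2 := h.inDeg_le v
  have h3 := h.two_le
  unfold IsLarge deg at hv
  omega

theorem adj_or_adj_of_in (h : D.IsColoredB c a) {v w w' : V} (hv : D.IsLarge a v)
    (hw : c w = !c v) (hw' : c w' = !c v) (hne : w ≠ w') : D.Adj w v ∨ D.Adj w' v := by
  by_contra! hcon
  have h1 := h.inDeg_add_le v {w, w'} (by rintro _ (rfl | rfl) <;> grind)
  rw [Set.ncard_pair hne] at h1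
  have h2 := h.outDeg_le v
  have h3 := h.two_le
  unfold IsLarge deg at hv
  omega

theorem adj_or_adj (h : D.IsColoredB c a) {v w w' : V} (hv : D.IsLarge a v)
    (hw : c w = !c v) (hw' : c w' = !c v) : D.Adj v w ∨ D.Adj w' v := by
  by_contra! hcon
  have h1 := h.inDeg_add_le v {w'} (by rintro _ rfl; grind)
  have h2 := h.outDeg_add_le v {w} (by rintro _ rfl; grind)
  rw [Set.ncard_singleton] at h1 h2
  have h3 := h.two_le
  unfold IsLarge deg at hv
  omega

/-- Distinct vertices that are not large have disjoint out-neighbourhoods, and a large vertex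
misses at most one of the possible in-neighbours. -/
theorem not_three_of_isLarge (h : D.IsColoredB c a) {y x₁ x₂ x₃ : V} (hy : D.IsLarge a y)
    (c₁ : c x₁ = !c y) (c₂ : c x₂ = !c y) (c₃ : c x₃ = !c y)
    (h₁ : ¬ D.IsLarge a x₁) (h₂ : ¬ D.IsLarge a x₂) (h₃ : ¬ D.IsLarge a x₃)
    (h₁₂ : x₁ ≠ x₂) (h₁₃ : x₁ ≠ x₃) (h₂₃ : x₂ ≠ x₃) : False := by
  have a₁₂ := h.adj_or_adj_of_in hy c₁ c₂ h₁₂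
  have a₁₃ := h.adj_or_adj_of_in hy c₁ c₃ h₁₃
  have a₂₃ := h.adj_or_adj_of_in hy c₂ c₃ h₂₃
  have d₁₂ := fun p q => (h.of_dominate (z := y) h₁₂ p q).1
  have d₁₃ := fun p q => (h.of_dominate (z := y) h₁₃ p q).1
  have d₂₃ := fun p q => (h.of_dominate (z := y) h₂₃ p q).1
  tauto

/-- Hall's condition is checked in each colour class. A set with a large vertex is either the whole
class, which dominates the whole other class, or has at most `a - 1` elements, no more than the
out-degree of that vertex. A set without large vertices has disjoint nonempty out-neighbourhoods. -/
theorem exists_cycle_factor (h : D.IsColoredB c a) : ∃ σ : Perm V, ∀ v, D.Adj v (σ v) := by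
  classical
  have := Fintype.ofFinite V
  set t : V → Finset V := fun v => Finset.univ.filter (D.Adj v) with ht
  have memt : ∀ v w, w ∈ t v ↔ D.Adj v w := by simp [ht]
  have cardt : ∀ v, (t v).card = D.outDeg v := by
    intro v
    rw [outDeg, Set.ncard_eq_toFinset_card']
    congr 1
    ext w
    simp [ht]
  have cardc : ∀ b, (Finset.univ.filter (c · = b)).card = a := by
    intro b
    rw [← h.card b, Set.ncard_eq_toFinset_card']
    congr 1
    ext w
    simp
  have mono : ∀ (b : Bool) (S : Finset V), (∀ v ∈ S, c v = b) →
      S.card ≤ (S.biUnion t).card := by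
    intro b S hS
    by_cases hl : ∃ x ∈ S, D.IsLarge a x
    · obtain ⟨x, hxS, hx⟩ := hl
      by_cases hfull : S = Finset.univ.filter (c · = b)
      · rw [hfull, cardc, ← cardc (!b)]
        refine Finset.card_le_card fun w hw => ?_
        obtain ⟨v, hv⟩ := h.exists_adj_to w
        have := h.color _ _ hv
        simp only [Finset.mem_filter, Finset.mem_univ, true_and] at hw
        rw [Finset.mem_biUnion]
        refine ⟨v, ?_, (memt _ _).2 hv⟩
        simpa using Bool.not_inj (this.symm.trans hw)
      · have h1 : S.card < a := by
          rw [← cardc b]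
          refine Finset.card_lt_card (Finset.ssubset_iff_subset_ne.2 ⟨fun v hv => ?_, hfull⟩)
          simpa using hS v hv
        have h2 : (t x).card ≤ (S.biUnion t).card :=
          Finset.card_le_card (Finset.subset_biUnion_of_mem t hxS)
        rw [cardt] at h2
        have h3 := h.inDeg_le x
        unfold IsLarge deg at hx
        omega
    · push Not at hl
      refine Finset.card_le_card_biUnion ?_ ?_
      · intro x hx y hy hxy
        refine Finset.disjoint_left.2 fun z hz hz' => ?_
        have := (h.of_dominate hxy ((memt _ _).1 hz) ((memt _ _).1 hz')).1
        exact this.elim (hl x hx) (hl y hy)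
      · intro x _
        obtain ⟨w, hw⟩ := h.exists_adj_from x
        exact ⟨w, (memt _ _).2 hw⟩
  have hall : ∀ S : Finset V, S.card ≤ (S.biUnion t).card := by
    intro S
    have e1 := mono true (S.filter (c · = true)) (by simp)
    have e2 := mono false (S.filter (¬ c · = true)) (by simp)
    have hd : Disjoint ((S.filter (c · = true)).biUnion t)
        ((S.filter (¬ c · = true)).biUnion t) := by
      refine Finset.disjoint_left.2 fun z hz hz' => ?_
      simp only [Finset.mem_biUnion, Finset.mem_filter, memt] at hz hz'
      obtain ⟨p, ⟨-, hp⟩, hpz⟩ := hz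
      obtain ⟨q, ⟨-, hq⟩, hqz⟩ := hz'
      have := h.color _ _ hpz
      have := h.color _ _ hqz
      grind
    calc S.card = (S.filter (c · = true)).card + (S.filter (¬ c · = true)).card :=
          (Finset.card_filter_add_card_filter_not _).symm
      _ ≤ _ := Nat.add_le_add e1 e2
      _ = _ := (Finset.card_union_of_disjoint hd).symm
      _ ≤ _ := Finset.card_le_card (Finset.union_subset
          (Finset.biUnion_subset_biUnion_of_subset_left _ (Finset.filter_subset _ _))
          (Finset.biUnion_subset_biUnion_of_subset_left _ (Finset.filter_subset _ _)))
  obtain ⟨f, hf, hft⟩ := (Finset.all_card_le_biUnion_card_iff_exists_injective t).1 hall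
  exact ⟨Equiv.ofBijective f (Finite.injective_iff_bijective.1 hf), fun v => (memt _ _).1 (hft v)⟩

end IsColoredB

end Digraph

/-! ### Excluding a single remaining cycle of length two -/

namespace Digraph

open Equiv Equiv.Perm

variable {V : Type*}

/-- A cycle factor, given by its successor map, no two cycles of which can be merged by exchanging
the successors of two vertices. -/
structure IsUnmergeableFactor (D : Digraph V) (c : V → Bool) (a : ℕ) (σ : Perm V) : Prop extends
    D.IsColoredB c a where
  adj : ∀ v, D.Adj v (σ v)
  unmergeable : ∀ x u, ¬ σ.SameCycle x u → D.Adj x (σ u) → ¬ D.Adj u (σ x)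

/-- The complement of the cycle of `x` is a single cycle, of length two, with vertices `u`, `v`. -/
structure IsTwoCycleComplement (σ : Perm V) (x u v : V) : Prop where
  left : σ u = v
  right : σ v = u
  not_sameCycle : ¬ σ.SameCycle x u
  sameCycle : ∀ w, w ≠ u → w ≠ v → σ.SameCycle x w

namespace IsTwoCycleComplement

variable {σ : Perm V} {x u v : V}

theorem symm (l : IsTwoCycleComplement σ x u v) : IsTwoCycleComplement σ x v u where
  left := l.right
  right := l.left
  not_sameCycle := by
    have := l.not_sameCycle
    rwa [← sameCycle_apply_right, l.left] at this
  sameCycle := fun w h1 h2 => l.sameCycle w h2 h1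

theorem eq_or_eq (l : IsTwoCycleComplement σ x u v) {w : V} (hw : ¬ σ.SameCycle x w) :
    w = u ∨ w = v := by
  by_contra! hcon
  exact hw (l.sameCycle w hcon.1 hcon.2)

theorem ne_of_sameCycle (l : IsTwoCycleComplement σ x u v) {w : V} (hw : σ.SameCycle x w) :
    w ≠ u ∧ w ≠ v :=
  ⟨fun h => l.not_sameCycle (h ▸ hw), fun h => l.symm.not_sameCycle (h ▸ hw)⟩

theorem not_sameCycle_of (l : IsTwoCycleComplement σ x u v) {w : V} (hw : σ.SameCycle x w) :
    ¬ σ.SameCycle w u :=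
  fun h => l.not_sameCycle (hw.trans h)

end IsTwoCycleComplement

namespace IsUnmergeableFactor

variable {D : Digraph V} {c : V → Bool} {a : ℕ} {σ : Perm V}

theorem color_apply (h : D.IsUnmergeableFactor c a σ) (v : V) : c (σ v) = !c v :=
  h.color _ _ (h.adj v)

theorem color_symm_apply (h : D.IsUnmergeableFactor c a σ) (v : V) : c (σ.symm v) = !c v := by
  have := h.color_apply (σ.symm v)
  simp [apply_symm_apply] at this
  simp [this]

theorem le_deg_of_adj (h : D.IsUnmergeableFactor c a σ) {x u v : V}
    (l : IsTwoCycleComplement σ x u v) (hw : ∃ w, σ.SameCycle x w ∧ (D.Adj u w ∨ D.Adj w v)) :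
    a + 1 ≤ D.deg u := by
  obtain ⟨w, hw, h1 | h1⟩ := hw
  · have hs : σ.SameCycle x (σ.symm w) := sameCycle_symm_apply_right.2 hw
    exact (h.of_dominate (l.ne_of_sameCycle hs).1.symm h1 (by simpa using h.adj (σ.symm w))).2.1
  · exact (h.of_dominate (l.ne_of_sameCycle hw).1.symm (l.left ▸ h.adj u) h1).2.1

theorem exists_adj_out (h : D.IsUnmergeableFactor c a σ) {x u v : V}
    (l : IsTwoCycleComplement σ x u v) : ∃ w, σ.SameCycle x w ∧ (D.Adj u w ∨ D.Adj v w) := by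
  obtain ⟨p, hp, q, hq, hpq⟩ := h.strong.exists_adj_leaving (S := {w | ¬ σ.SameCycle x w})
    (x := u) (y := x) l.not_sameCycle (by simp [SameCycle.refl])
  refine ⟨q, by simpa using hq, ?_⟩
  rcases l.eq_or_eq hp with rfl | rfl <;> simp [hpq]

theorem exists_adj_in (h : D.IsUnmergeableFactor c a σ) {x u v : V}
    (l : IsTwoCycleComplement σ x u v) : ∃ w, σ.SameCycle x w ∧ (D.Adj w u ∨ D.Adj w v) := by
  obtain ⟨p, hp, q, hq, hpq⟩ := h.strong.exists_adj_leaving (S := {w | σ.SameCycle x w})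
    (x := x) (y := u) (SameCycle.refl _ _) l.not_sameCycle
  refine ⟨p, hp, ?_⟩
  rcases l.eq_or_eq hq with rfl | rfl <;> simp [hpq]

variable [Finite V]

/-- Otherwise `u` sends nothing to the cycle of `x` and `v` receives nothing from it. By strongness
`v` then has an arc to that cycle, so degree at least `a + 1`, but in-degree at most 1; hence it
dominates the whole opposite class. An arc `q → u` from the cycle, which strongness also gives,
forbids `v → σ q`. -/
theorem le_deg (h : D.IsUnmergeableFactor c a σ) {x u v : V}
    (l : IsTwoCycleComplement σ x u v) : a + 1 ≤ D.deg u := by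
  by_contra hdeg
  have hno : ∀ w, σ.SameCycle x w → ¬ D.Adj u w ∧ ¬ D.Adj w v := by
    intro w hw
    by_contra hcon
    exact hdeg (h.le_deg_of_adj l ⟨w, hw, by tauto⟩)
  obtain ⟨p, hp, hp'⟩ := h.exists_adj_out l
  obtain ⟨q, hq, hq'⟩ := h.exists_adj_in l
  have hvp : D.Adj v p := hp'.resolve_left (hno p hp).1
  have hqu : D.Adj q u := hq'.resolve_right (hno q hq).2
  have hv : a + 1 ≤ D.deg v := h.le_deg_of_adj l.symm ⟨p, hp, Or.inl hvp⟩
  have hin : D.inDeg v ≤ 1 := by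
    rw [inDeg, ← Set.ncard_singleton u]
    refine Set.ncard_le_ncard (fun w (hw : D.Adj w v) => ?_) (Set.toFinite _)
    by_contra hwu
    have hwv : w ≠ v := by
      rintro rfl
      simpa using h.color _ _ hw
    exact (hno w (l.sameCycle w hwu hwv)).2 hw
  have hsq : σ.SameCycle x (σ q) := sameCycle_apply_right.2 hq
  have hcq : c (σ q) = !c v := by
    have e1 := h.color _ _ hqu
    have e2 := h.color_apply q
    have e3 := h.color_apply u
    rw [l.left] at e3
    simp_all
  have hnot : ¬ D.Adj v (σ q) := by
    refine h.unmergeable q v (l.symm.not_sameCycle_of hq) ?_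
    rwa [l.right]
  have := h.outDeg_add_le v {σ q} (by rintro _ rfl; exact ⟨hcq, hnot⟩)
  rw [Set.ncard_singleton] at this
  unfold deg at hv
  omega

/-- Pulled back along `σ`, the out-neighbours of `u` lie in the colour class of `u`, as do the
in-neighbours of `v`. A common element other than `u` would permit a merge, so the two sets overlap
only in `u`. The set `S` records elements outside both. -/
theorem outDeg_add_inDeg_le (h : D.IsUnmergeableFactor c a σ) {x u v : V}
    (l : IsTwoCycleComplement σ x u v) (S : Set V)
    (hS : ∀ w ∈ S, c w = c u ∧ ¬ D.Adj w v ∧ ¬ D.Adj u (σ w)) :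
    D.outDeg u + D.inDeg v + S.ncard ≤ a + 1 := by
  set A := {w | D.Adj u (σ w)} with hA
  set B := {w | D.Adj w v} with hB
  have eA : D.outDeg u = A.ncard := by
    rw [← Set.ncard_image_of_injective A σ.injective, outDeg]
    congr 1
    ext w
    refine ⟨fun hw => ⟨σ.symm w, by simpa [hA] using hw, by simp⟩, ?_⟩
    rintro ⟨z, hz, rfl⟩
    exact hz
  have hcv : c v = !c u := l.left ▸ h.color_apply u
  have hAB : (A ∩ B).ncard ≤ 1 := by
    rw [← Set.ncard_singleton u]
    refine Set.ncard_le_ncard (fun w hw => ?_) (Set.toFinite _)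
    by_contra hwu
    have hwv : w ≠ v := by
      rintro rfl
      simpa using h.color _ _ hw.2
    refine h.unmergeable w u (l.not_sameCycle_of (l.sameCycle w hwu hwv)) ?_ hw.1
    rw [l.left]
    exact hw.2
  have hdisj : Disjoint (A ∪ B) S := by
    refine Set.disjoint_left.2 fun w hw hwS => ?_
    have := hS w hwS
    rcases hw with hw | hw
    · exact this.2.2 hw
    · exact this.2.1 hw
  have hun : (A ∪ B).ncard + S.ncard ≤ a := by
    rw [← Set.ncard_union_eq hdisj (Set.toFinite _) (Set.toFinite _), ← h.card (c u)]
    refine Set.ncard_le_ncard ?_ (Set.toFinite _)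
    rintro w ((hw | hw) | hw)
    · have e1 := h.color _ _ hw
      have e2 := h.color_apply w
      simp_all
    · have e1 := h.color _ _ hw
      simp_all
    · exact (hS w hw).1
  have := Set.ncard_union_add_ncard_inter A B (Set.toFinite _) (Set.toFinite _)
  have eB : D.inDeg v = B.ncard := rfl
  omega

/-- The previous bound for `u, v` and for `v, u` adds up to `d(u) + d(v) ≤ 2a + 2`, whereas both
degrees are at least `a + 1`. -/
theorem outDeg_add_inDeg_eq (h : D.IsUnmergeableFactor c a σ) {x u v : V}
    (l : IsTwoCycleComplement σ x u v) : D.outDeg u + D.inDeg v = a + 1 ∧ D.deg u = a + 1 := by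
  have e1 := h.outDeg_add_inDeg_le l ∅ (by simp)
  have e2 := h.outDeg_add_inDeg_le l.symm ∅ (by simp)
  have e3 := h.le_deg l
  have e4 := h.le_deg l.symm
  rw [Set.ncard_empty] at e1 e2
  unfold deg at *
  omega

theorem adj_or_adj_of_color (h : D.IsUnmergeableFactor c a σ) {x u v w : V}
    (l : IsTwoCycleComplement σ x u v) (hw : c w = c u) :
    D.Adj w v ∨ D.Adj u (σ w) := by
  by_contra! hcon
  have e1 := h.outDeg_add_inDeg_le l {w} (by rintro _ rfl; exact ⟨hw, hcon⟩)
  have e2 := (h.outDeg_add_inDeg_eq l).1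
  rw [Set.ncard_singleton] at e1
  omega

theorem isLarge_of_color (h : D.IsUnmergeableFactor c a σ) {x u v w : V}
    (l : IsTwoCycleComplement σ x u v) (hxw : σ.SameCycle x w) (hw : c w = c u) :
    D.IsLarge a w := by
  have hne := (l.ne_of_sameCycle hxw).1
  have key : (D.IsLarge a w ∨ D.IsLarge a u) ∧ a + 1 ≤ D.deg w ∧ a + 1 ≤ D.deg u := by
    rcases h.adj_or_adj_of_color l hw with h1 | h1
    · exact h.of_dominate hne h1 (l.left ▸ h.adj u)
    · exact h.of_dominate hne (h.adj w) h1
  -- If `u` is the large one, then `a + 1 ≥ 2a - 1`, and the bound `a + 1` already makes `w` large.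
  have e := (h.outDeg_add_inDeg_eq l).2
  have := h.two_le
  unfold IsLarge at *
  omega

theorem not_adj_symm_apply (h : D.IsUnmergeableFactor c a σ) {x u v w : V}
    (l : IsTwoCycleComplement σ x u v) (hxw : σ.SameCycle x w) (hw : c w = c u)
    (hv : ¬ D.Adj w v) : ¬ D.Adj (σ.symm w) u ∧ ¬ D.Adj (σ.symm w) v := by
  have hcv : c v = !c u := l.left ▸ h.color_apply u
  have hcs := h.color_symm_apply w
  refine ⟨fun hadj => ?_, fun hadj => ?_⟩
  · have hvw : D.Adj v w :=
      (h.adj_or_adj (h.isLarge_of_color l hxw hw) (by simp [*]) (by simp [*])).resolve_left hv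
    refine h.unmergeable (σ.symm w) v ?_ (l.right.symm ▸ hadj) (by simpa using hvw)
    exact l.symm.not_sameCycle_of (sameCycle_symm_apply_right.2 hxw)
  · have := h.color _ _ hadj
    simp_all

/-- Having no arc to `{u, v}` passes from a vertex of the cycle to its predecessor, so one such
vertex would leave `{u, v}` unreachable from the cycle. If there is none, take an arc from `{u, v}`
to some `w`: the predecessor of `w` has an arc into `{u, v}`, and the two arcs merge the cycles. -/
theorem not_isTwoCycleComplement (h : D.IsUnmergeableFactor c a σ) {x u v : V}
    (l : IsTwoCycleComplement σ x u v) : False := by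
  have hcv : c v = !c u := l.left ▸ h.color_apply u
  have hcol : ∀ w, c w = c u ∨ c w = c v := by
    intro w
    rw [hcv]
    cases c w <;> cases c u <;> simp
  by_cases hex : ∃ w, σ.SameCycle x w ∧ ¬ D.Adj w u ∧ ¬ D.Adj w v
  · obtain ⟨w, hxw, hw⟩ := hex
    obtain ⟨z, hz, hz'⟩ := h.exists_adj_in l
    have : σ.SameCycle x z ∧ ¬ D.Adj z u ∧ ¬ D.Adj z v := by
      refine sameCycle_induction (σ := σ⁻¹)
        (P := fun w => σ.SameCycle x w ∧ ¬ D.Adj w u ∧ ¬ D.Adj w v) ?_ ⟨hxw, hw⟩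
        (sameCycle_inv.2 (hxw.symm.trans hz))
      rintro y ⟨hy, hyu, hyv⟩
      refine ⟨sameCycle_symm_apply_right.2 hy, ?_⟩
      rcases hcol y with hc | hc
      · exact h.not_adj_symm_apply l hy hc hyv
      · exact (h.not_adj_symm_apply l.symm hy hc hyu).symm
    tauto
  · push Not at hex
    obtain ⟨w, hxw, hw⟩ := h.exists_adj_out l
    have hs : σ.SameCycle x (σ.symm w) := sameCycle_symm_apply_right.2 hxw
    have hcw := h.color_symm_apply w
    by_cases hu : D.Adj (σ.symm w) u
    · have e1 := h.color _ _ hu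
      rcases hw with hw | hw
      · rw [hcw, h.color _ _ hw] at e1
        simp at e1
      · exact h.unmergeable (σ.symm w) v (l.symm.not_sameCycle_of hs) (l.right.symm ▸ hu)
          (by simpa using hw)
    · have hv := hex _ hs hu
      have e1 := h.color _ _ hv
      rcases hw with hw | hw
      · exact h.unmergeable (σ.symm w) u (l.not_sameCycle_of hs) (l.left.symm ▸ hv)
          (by simpa using hw)
      · rw [hcw, h.color _ _ hw] at e1
        simp at e1

end IsUnmergeableFactor

end Digraph

/-! ### Large vertices on an unmergeable factor with several cycles -/

namespace Digraph

open Equiv Equiv.Perm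

namespace IsUnmergeableFactor

variable {V : Type*} [Finite V] {D : Digraph V} {c : V → Bool} {a : ℕ} {σ : Perm V}

theorem exists_two_not_sameCycle (h : D.IsUnmergeableFactor c a σ)
    (hσ : ∃ p q, ¬ σ.SameCycle p q) (x : V) :
    ∃ u w, u ≠ w ∧ c u = c x ∧ c w = c x ∧ ¬ σ.SameCycle x u ∧ ¬ σ.SameCycle x w := by
  obtain ⟨p, hp⟩ : ∃ p, ¬ σ.SameCycle x p := by
    by_contra! hcon
    obtain ⟨p, q, hpq⟩ := hσ
    exact hpq ((hcon p).symm.trans (hcon q))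
  obtain ⟨u, hcu, hu⟩ : ∃ u, c u = c x ∧ ¬ σ.SameCycle x u := by
    by_cases hc : c p = c x
    · exact ⟨p, hc, hp⟩
    · refine ⟨σ p, ?_, by rwa [sameCycle_apply_right]⟩
      rw [h.color_apply]
      revert hc
      cases c p <;> cases c x <;> simp
  by_contra! hcon
  have huniq : ∀ w, c w = c x → ¬ σ.SameCycle x w → w = u := by
    intro w hw hxw
    by_contra hne
    exact hxw (hcon u w (Ne.symm hne) hcu hw hu)
  have h2 : σ (σ u) = u := by
    refine huniq _ ?_ ?_
    · simp [h.color_apply, hcu]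
    · simpa only [sameCycle_apply_right] using hu
  refine h.not_isTwoCycleComplement (x := x) (u := u) (v := σ u) ⟨rfl, h2, hu, fun w h3 h4 => ?_⟩
  by_contra hw
  by_cases hc : c w = c x
  · exact h3 (huniq w hc hw)
  · have h5 : σ w = u := by
      refine huniq _ ?_ (by rwa [sameCycle_apply_right])
      rw [h.color_apply]
      revert hc
      cases c w <;> cases c x <;> simp
    exact h4 (σ.injective (h5.trans h2.symm))

theorem three_le (h : D.IsUnmergeableFactor c a σ) (hσ : ∃ p q, ¬ σ.SameCycle p q) : 3 ≤ a := by
  have hσ' := hσ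
  obtain ⟨x, -⟩ := hσ'
  obtain ⟨u, w, huw, hu, hw, hxu, hxw⟩ := h.exists_two_not_sameCycle hσ x
  have hux : u ≠ x := fun e => hxu (e ▸ SameCycle.refl _ _)
  have hwx : w ≠ x := fun e => hxw (e ▸ SameCycle.refl _ _)
  rw [← h.card (c x), ← Set.ncard_eq_three.2 ⟨x, u, w, hux.symm, hwx.symm, huw, rfl⟩]
  refine Set.ncard_le_ncard ?_ (Set.toFinite _)
  rintro z (rfl | rfl | rfl)
  · rfl
  · exact hu
  · exact hw

/-- The missing arcs `x → σ u₁` and `u₂ → σ x` are the only ones that `x` and `σ x` can miss. All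
arcs into `x` and out of `σ x` are thus present, so unmergeability bars arcs from the predecessor of
`x` to other cycles, and from other cycles to the successor of `σ x`. These two vertices are
therefore not large. -/
theorem not_isLarge_apply_aux (h : D.IsUnmergeableFactor c a σ) {x u₁ u₂ : V}
    (hx : D.IsLarge a x) (hy : D.IsLarge a (σ x)) (hne : u₁ ≠ u₂) (c₁ : c u₁ = c x)
    (c₂ : c u₂ = c x) (n₁ : ¬ σ.SameCycle x u₁) (n₂ : ¬ σ.SameCycle x u₂)
    (hx₁ : ¬ D.Adj x (σ u₁)) (hy₂ : ¬ D.Adj u₂ (σ x)) : False := by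
  have hcy := h.color_apply x
  have hσc : ∀ u, c u = c x → c (σ u) = !c x := fun u hu => by rw [h.color_apply, hu]
  have hsc : ∀ u, c u = c x → c (σ.symm u) = !c x := fun u hu => by
    rw [h.color_symm_apply, hu]
  have hσne : σ u₁ ≠ σ u₂ := fun e => hne (σ.injective e)
  have x_in : ∀ w, c w = !c x → D.Adj w x := fun w hw =>
    (h.adj_or_adj hx (hσc u₁ c₁) hw).resolve_left hx₁
  have y_out : ∀ w, c w = c x → D.Adj (σ x) w := fun w hw =>
    (h.adj_or_adj hy (by simp [hcy, hw]) (by simp [hcy, c₂])).resolve_right hy₂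
  set w := σ.symm x with hw
  have hxw : σ.SameCycle x w := sameCycle_symm_apply_right.2 (SameCycle.refl _ _)
  set z := σ (σ x) with hz
  have hcz : c z = c x := by simp [hz, h.color_apply]
  have hcw : c w = !c x := h.color_symm_apply x
  have hxz : σ.SameCycle x z :=
    sameCycle_apply_right.2 (sameCycle_apply_right.2 (SameCycle.refl _ _))
  have w_out : ∀ u, c u = c x → ¬ σ.SameCycle x u → ¬ D.Adj w u := by
    intro u hcu hxu hwu
    refine h.unmergeable w (σ.symm u) ?_ (by simpa using hwu) (by simpa [hw] using x_in _ (hsc u hcu))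
    rw [sameCycle_symm_apply_right]
    exact fun hs => hxu (hxw.trans hs)
  have z_in : ∀ v, c v = !c x → ¬ σ.SameCycle x v → ¬ D.Adj v z := by
    intro v hcv hxv hvz
    refine h.unmergeable (σ x) v ?_ (y_out _ (by rw [h.color_apply, hcv]; simp)) hvz
    rwa [sameCycle_apply_left]
  have n₁' : ¬ σ.SameCycle x (σ u₁) := by rwa [sameCycle_apply_right]
  have n₂' : ¬ σ.SameCycle x (σ u₂) := by rwa [sameCycle_apply_right]
  have w_small : ¬ D.IsLarge a w := fun hl =>
    (h.adj_or_adj_of_out hl (by simp [hcw, c₁]) (by simp [hcw, c₂]) hne).elim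
      (w_out _ c₁ n₁) (w_out _ c₂ n₂)
  have z_small : ¬ D.IsLarge a z := fun hl =>
    (h.adj_or_adj_of_in hl (by rw [hcz]; exact hσc _ c₁) (by rw [hcz]; exact hσc _ c₂) hσne).elim
      (z_in _ (hσc _ c₁) n₁') (z_in _ (hσc _ c₂) n₂')
  have off : ∀ {p q}, σ.SameCycle x p → ¬ σ.SameCycle x q → p ≠ q :=
    fun hp hq e => hq (e ▸ hp)
  -- a large vertex off the cycle of `x`, on the side of `x`, can only be `u₁`
  have hu₂ : ¬ D.IsLarge a u₂ := by
    intro hl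
    have h1 := h.adj_or_adj hl (w := σ x) (w' := w) (by rw [c₂, hcy]) (by rw [c₂, hcw])
    exact h1.elim hy₂ (w_out _ c₂ n₂)
  have hu₁ : D.IsLarge a u₁ := by
    by_contra hl
    exact h.not_three_of_isLarge hy (by simp [hcz, hcy]) (by simp [c₁, hcy]) (by simp [c₂, hcy])
      z_small hl hu₂ (off hxz n₁) (off hxz n₂) hne
  have hv₁ : ¬ D.IsLarge a (σ u₁) := by
    intro hl
    have h1 := h.adj_or_adj hl (w := z) (w' := x) (by simp [hcz, hσc _ c₁])
      (by simp [hσc _ c₁])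
    exact h1.elim (z_in _ (hσc _ c₁) n₁') hx₁
  have hv₂ : D.IsLarge a (σ u₂) := by
    by_contra hl
    exact h.not_three_of_isLarge hx hcw (hσc _ c₁) (hσc _ c₂) w_small hv₁ hl
      (off hxw n₁') (off hxw n₂') hσne
  have hzv : D.Adj z (σ u₂) :=
    (h.adj_or_adj hv₂ (w := z) (w' := z) (by simp [hcz, hσc _ c₂])
      (by simp [hcz, hσc _ c₂])).resolve_left (z_in _ (hσc _ c₂) n₂')
  exact (h.of_dominate (off hxz n₂) hzv (h.adj u₂)).1.elim z_small hu₂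

/-- For two outside vertices `u`, `w`, largeness gives an arc from `x` to `σ u` or `σ w`, and one to
`σ x` from `u` or `w`. Unmergeability forces these to be crossed, which the auxiliary lemma
excludes. -/
theorem not_isLarge_apply (h : D.IsUnmergeableFactor c a σ) (hσ : ∃ p q, ¬ σ.SameCycle p q)
    {x : V} (hx : D.IsLarge a x) : ¬ D.IsLarge a (σ x) := by
  intro hy
  obtain ⟨u, w, hne, hu, hw, hxu, hxw⟩ := h.exists_two_not_sameCycle hσ x
  have hcy := h.color_apply x
  have h1 := h.adj_or_adj_of_out hx (w := σ u) (w' := σ w) (by rw [h.color_apply, hu])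
    (by rw [h.color_apply, hw]) (fun e => hne (σ.injective e))
  have h2 := h.adj_or_adj_of_in hy (w := u) (w' := w) (by simp [hcy, hu]) (by simp [hcy, hw]) hne
  have h3 := h.unmergeable x u hxu
  have h4 := h.unmergeable x w hxw
  have h5 := h.not_isLarge_apply_aux hx hy hne hu hw hxu hxw
  have h6 := h.not_isLarge_apply_aux hx hy hne.symm hw hu hxw hxu
  tauto

/-- Without large vertices of colour `b`, the other colour has in-degrees at most 1, hence degrees
at most `a + 1 < 2a - 1`. No vertex is then large, yet an arc between two cycles creates a
dominating pair. -/
theorem exists_isLarge (h : D.IsUnmergeableFactor c a σ) (hσ : ∃ p q, ¬ σ.SameCycle p q)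
    (b : Bool) : ∃ v, c v = b ∧ D.IsLarge a v := by
  by_contra! hcon
  have ha := h.three_le hσ
  have hin : ∀ z, c z = !b → ¬ D.IsLarge a z := by
    intro z hz hl
    have : D.inDeg z ≤ 1 := by
      rw [inDeg, Set.ncard_le_one (Set.toFinite _)]
      intro p hp q hq
      by_contra hne
      have e1 := h.color _ _ hp
      have e2 := h.color _ _ hq
      rw [hz] at e1 e2
      exact (h.of_dominate hne hp hq).1.elim (hcon p (Bool.not_inj e1.symm))
        (hcon q (Bool.not_inj e2.symm))
    have := h.outDeg_le z
    unfold IsLarge deg at hl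
    omega
  have hnone : ∀ z, ¬ D.IsLarge a z := by
    intro z
    by_cases hz : c z = b
    · exact hcon z hz
    · refine hin z ?_
      revert hz
      cases c z <;> cases b <;> simp
  obtain ⟨p, q, hpq⟩ := hσ
  obtain ⟨y, hy, z, hz, hyz⟩ := h.strong.exists_adj_leaving (S := {w | σ.SameCycle p w})
    (x := p) (y := q) (SameCycle.refl _ _) hpq
  have hne : y ≠ σ.symm z := by
    rintro rfl
    exact hz (sameCycle_symm_apply_right.1 hy)
  exact (h.of_dominate hne hyz (by simpa using h.adj (σ.symm z))).1.elim (hnone _) (hnone _)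

theorem not_two_not_isLarge_aux (h : D.IsUnmergeableFactor c a σ)
    (hσ : ∃ p q, ¬ σ.SameCycle p q) {x₁ x₂ : V} (hne : x₁ ≠ x₂) (hc : c x₂ = c x₁)
    (hx₁ : ¬ D.IsLarge a x₁) (hx₂ : ¬ D.IsLarge a x₂) (hy : D.IsLarge a (σ x₁)) : False := by
  have ha := h.three_le hσ
  have hcy := h.color_apply x₁
  have hlarge : ∀ w, c w = c x₁ → w ≠ x₁ → w ≠ x₂ → D.IsLarge a w := by
    intro w hw h1 h2
    by_contra hl
    exact h.not_three_of_isLarge hy (by simp [hcy]) (by simp [hcy, hc]) (by simp [hcy, hw])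
      hx₁ hx₂ hl hne h1.symm h2.symm
  have hx₂y : ¬ D.Adj x₂ (σ x₁) := fun hadj =>
    (h.of_dominate hne (h.adj x₁) hadj).1.elim hx₁ hx₂
  have hx₁y : ¬ D.Adj x₁ (σ x₂) := fun hadj =>
    (h.of_dominate hne hadj (h.adj x₂)).1.elim hx₁ hx₂
  have y_in : ∀ w, c w = c x₁ → w ≠ x₂ → D.Adj w (σ x₁) := fun w hw h2 =>
    (h.adj_or_adj_of_in hy (by simp [hcy, hw]) (by simp [hcy, hc]) h2).resolve_right hx₂y
  have y_out : ∀ w, c w = c x₁ → D.Adj (σ x₁) w := fun w hw =>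
    (h.adj_or_adj hy (by simp [hcy, hw]) (by simp [hcy, hc])).resolve_right hx₂y
  obtain ⟨u, w, huw, hcu, hcw, hu, hw⟩ := h.exists_two_not_sameCycle hσ x₁
  have hu₁ : u ≠ x₁ := fun e => hu (e ▸ SameCycle.refl _ _)
  have hw₁ : w ≠ x₁ := fun e => hw (e ▸ SameCycle.refl _ _)
  have hdeg : a + 1 ≤ D.deg x₁ := by
    by_cases h2 : u = x₂
    · exact (h.of_dominate hw₁.symm (h.adj x₁) (y_in w hcw (h2 ▸ huw.symm))).2.1
    · exact (h.of_dominate hu₁.symm (h.adj x₁) (y_in u hcu h2)).2.1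
  -- An arc to another cycle would merge with the arc into `σ x₁` from the predecessor of its head;
  -- only `x₂` has no such arc, and `x₁` does not dominate `σ x₂`.
  have hcycle : ∀ t, D.Adj x₁ t → σ.SameCycle x₁ t := by
    intro t ht
    by_contra hs
    have hs' : ¬ σ.SameCycle x₁ (σ.symm t) := by rwa [sameCycle_symm_apply_right]
    have hst : c (σ.symm t) = c x₁ := by rw [h.color_symm_apply, h.color _ _ ht]; simp
    refine h.unmergeable x₁ (σ.symm t) hs' (by simpa using ht) (y_in _ hst ?_)
    rintro e
    refine hx₁y ?_
    rw [← e]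
    simpa using ht
  have hcy2 : c (σ (σ x₁)) = c x₁ := by simp [h.color_apply]
  have hy2 : ¬ D.IsLarge a (σ (σ x₁)) := h.not_isLarge_apply hσ hy
  have s1 : σ.SameCycle x₁ (σ x₁) := sameCycle_apply_right.2 (SameCycle.refl _ _)
  -- The successor of the large `σ x₁` is not large, so it is `x₁` or `x₂`. A cycle of length 2 or 4
  -- through `x₁` would give it degree at most 2 or 3, below `a + 1 ≥ 4`.
  by_cases e1 : σ (σ x₁) = x₁
  · have hclosed : ∀ w, σ.SameCycle x₁ w → w = x₁ ∨ w = σ x₁ := fun w hw =>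
      sameCycle_induction (P := fun w => w = x₁ ∨ w = σ x₁)
        (by rintro _ (rfl | rfl) <;> simp [e1]) (Or.inl rfl) hw
    have ho : D.outDeg x₁ ≤ 1 := by
      rw [outDeg, ← Set.ncard_singleton (σ x₁)]
      refine Set.ncard_le_ncard (fun t (ht : D.Adj x₁ t) => ?_) (Set.toFinite _)
      refine (hclosed t (hcycle t ht)).resolve_left ?_
      rintro rfl
      simpa using h.color _ _ ht
    have hi : D.inDeg x₁ ≤ 1 := by
      rw [inDeg, ← Set.ncard_singleton (σ x₁)]
      refine Set.ncard_le_ncard (fun t (ht : D.Adj t x₁) => ?_) (Set.toFinite _)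
      have hct := h.color _ _ ht
      by_cases hs : σ.SameCycle x₁ t
      · refine (hclosed t hs).resolve_left ?_
        rintro rfl
        simp at hct
      · refine absurd (e1.symm ▸ ht) (h.unmergeable (σ x₁) t ?_ (y_out _ ?_))
        · rwa [sameCycle_apply_left]
        · rw [h.color_apply, hct]
    unfold deg at hdeg
    omega
  · have e2 : σ (σ x₁) = x₂ := by
      by_contra e2
      exact hy2 (hlarge _ hcy2 e1 e2)
    have s2 : σ.SameCycle x₁ x₂ := e2 ▸ sameCycle_apply_right.2 s1
    have s3 : σ.SameCycle x₁ (σ x₂) := sameCycle_apply_right.2 s2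
    have hcy' : c (σ x₂) = !c x₁ := by rw [h.color_apply, hc]
    by_cases hy' : D.IsLarge a (σ x₂)
    · have hcy3 : c (σ (σ x₂)) = c x₁ := by simp [h.color_apply, hc]
      have e3 : σ (σ x₂) = x₁ := by
        by_contra e3
        refine h.not_isLarge_apply hσ hy' (hlarge _ hcy3 e3 fun e4 => ?_)
        exact hne (σ.injective (σ.injective (e2.trans e4.symm)))
      have hclosed : ∀ w, σ.SameCycle x₁ w → w = x₁ ∨ w = σ x₁ ∨ w = x₂ ∨ w = σ x₂ := fun w hw =>
        sameCycle_induction (P := fun w => w = x₁ ∨ w = σ x₁ ∨ w = x₂ ∨ w = σ x₂)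
          (by rintro w (e | e | e | e) <;> simp [e, e2, e3]) (Or.inl rfl) hw
      have y'_out : ∀ w, c w = c x₁ → D.Adj (σ x₂) w := fun w hw =>
        (h.adj_or_adj hy' (by simp [hcy', hw]) (by simp [hcy'])).resolve_right hx₁y
      have ho : D.outDeg x₁ ≤ 1 := by
        rw [outDeg, ← Set.ncard_singleton (σ x₁)]
        refine Set.ncard_le_ncard (fun t (ht : D.Adj x₁ t) => ?_) (Set.toFinite _)
        have hct := h.color _ _ ht
        rcases hclosed t (hcycle t ht) with rfl | rfl | rfl | rfl
        · simp at hct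
        · rfl
        · simp [hc] at hct
        · exact absurd ht hx₁y
      have hi : D.inDeg x₁ ≤ 2 := by
        rw [inDeg, ← Set.ncard_pair (a := σ x₁) (b := σ x₂) (fun e => hne (σ.injective e))]
        refine Set.ncard_le_ncard (fun t (ht : D.Adj t x₁) => ?_) (Set.toFinite _)
        have hct := h.color _ _ ht
        by_cases hs : σ.SameCycle x₁ t
        · rcases hclosed t hs with rfl | rfl | rfl | rfl
          · simp at hct
          · simp
          · simp [hc] at hct
          · simp
        · refine absurd (e3.symm ▸ ht) (h.unmergeable (σ x₂) t ?_ (y'_out _ ?_))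
          · exact fun hs' => hs (s3.trans hs')
          · rw [h.color_apply, hct]
      unfold deg at hdeg
      omega
    -- Now `σ x₂`, `σ u`, `σ w` are three non-large vertices of one colour, opposite the large
    -- vertex `u`.
    · have hu₂ : u ≠ x₂ := fun e => hu (e ▸ s2)
      have hw₂ : w ≠ x₂ := fun e => hw (e ▸ s2)
      have lu := hlarge u hcu hu₁ hu₂
      have lw := hlarge w hcw hw₁ hw₂
      exact h.not_three_of_isLarge lu (x₁ := σ x₂) (x₂ := σ u) (x₃ := σ w) (by simp [hcy', hcu])
        (by simp [h.color_apply]) (by simp [h.color_apply, hcw, hcu]) hy'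
        (h.not_isLarge_apply hσ lu) (h.not_isLarge_apply hσ lw)
        (fun e => hu₂ (σ.injective e).symm) (fun e => hw₂ (σ.injective e).symm)
        (fun e => huw (σ.injective e))

theorem not_two_not_isLarge (h : D.IsUnmergeableFactor c a σ)
    (hσ : ∃ p q, ¬ σ.SameCycle p q) {x₁ x₂ : V} (hne : x₁ ≠ x₂) (hc : c x₂ = c x₁)
    (hx₁ : ¬ D.IsLarge a x₁) (hx₂ : ¬ D.IsLarge a x₂) : False := by
  obtain ⟨y, hcy, hy⟩ := h.exists_isLarge hσ (!c x₁)
  have hcx : c (σ.symm y) = c x₁ := by simp [h.color_symm_apply, hcy]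
  have hny : ¬ D.IsLarge a (σ.symm y) := fun hl => h.not_isLarge_apply hσ hl (by simpa using hy)
  by_cases e1 : σ.symm y = x₁
  · exact h.not_two_not_isLarge_aux hσ hne hc hx₁ hx₂ (by rw [← e1]; simpa using hy)
  by_cases e2 : σ.symm y = x₂
  · exact h.not_two_not_isLarge_aux hσ hne.symm hc.symm hx₂ hx₁ (by rw [← e2]; simpa using hy)
  exact h.not_three_of_isLarge hy (by simp [hcy]) (by simp [hcy, hc]) (by simp [hcy, hcx])
    hx₁ hx₂ hny hne (Ne.symm e1) (Ne.symm e2)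

theorem sameCycle (h : D.IsUnmergeableFactor c a σ) (p q : V) : σ.SameCycle p q := by
  by_contra hpq
  have hσ : ∃ p q, ¬ σ.SameCycle p q := ⟨p, q, hpq⟩
  have ha := h.three_le hσ
  set L := {v | D.IsLarge a v} with hL
  -- `σ` injects the large vertices into the others.
  have hle : L.ncard ≤ Lᶜ.ncard := by
    rw [← Set.ncard_image_of_injective L σ.injective]
    refine Set.ncard_le_ncard ?_ (Set.toFinite _)
    rintro _ ⟨v, hv, rfl⟩
    exact h.not_isLarge_apply hσ hv
  have hsmall : ∀ b, ({v | c v = b} \ L).ncard ≤ 1 := by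
    intro b
    rw [Set.ncard_le_one (Set.toFinite _)]
    rintro x ⟨hxc, hx⟩ y ⟨hyc, hy⟩
    by_contra hne
    exact h.not_two_not_isLarge hσ hne (hyc.trans hxc.symm) hx hy
  have hcompl : Lᶜ.ncard ≤ 2 := by
    have e : Lᶜ = ({v | c v = true} \ L) ∪ ({v | c v = false} \ L) := by
      ext v
      cases hv : c v <;> simp [hv]
    rw [e]
    exact (Set.ncard_union_le _ _).trans (Nat.add_le_add (hsmall true) (hsmall false))
  have htot : a + a ≤ L.ncard + Lᶜ.ncard := by
    rw [Set.ncard_add_ncard_compl, ← Set.ncard_univ]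
    nth_rewrite 1 [← h.card true]
    rw [← h.card false, ← Set.ncard_union_eq _ (Set.toFinite _) (Set.toFinite _)]
    · exact Set.ncard_le_ncard (Set.subset_univ _) (Set.toFinite _)
    · exact Set.disjoint_left.2 fun v (h1 : c v = true) (h2 : c v = false) => by simp [h1] at h2
  omega

end IsUnmergeableFactor

theorem isHamiltonian_of_conditionB {V : Type*} {D : Digraph V} {a : ℕ} (ha : 2 ≤ a)
    (hcard : Nat.card V = 2 * a) (hbip : D.IsBalancedBipartite) (hstr : D.IsStrong)
    (hB : D.ConditionB a 1) : D.IsHamiltonian := by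
  classical
  have : Finite V := Nat.finite_of_card_ne_zero (by omega)
  obtain ⟨X, Y, hdisj, hun, hX, hY, hXY⟩ := hbip
  have hnot : ∀ v, v ∉ X ↔ v ∈ Y := by
    intro v
    refine ⟨fun hv => ?_, fun hv hv' => Set.disjoint_left.1 hdisj hv' hv⟩
    have : v ∈ X ∪ Y := hun ▸ Set.mem_univ v
    exact this.resolve_left hv
  have hsum : X.ncard + Y.ncard = 2 * a := by
    rw [← Set.ncard_union_eq hdisj (Set.toFinite _) (Set.toFinite _), hun, Set.ncard_univ, hcard]
  have h : D.IsColoredB (fun v => decide (v ∈ X)) a := by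
    refine ⟨fun u v huv => ?_, fun b => ?_, ha, hB, hstr⟩
    · by_cases hu : u ∈ X
      · have hv : v ∉ X := fun hv => hX u hu v hv huv
        simp [hu, hv]
      · have hv : v ∈ X := by
          by_contra hv
          exact hY u ((hnot u).1 hu) v ((hnot v).1 hv) huv
        simp [hu, hv]
    · cases b
      · simp only [decide_eq_false_iff_not, hnot, Set.ofPred_mem_eq]
        omega
      · simp only [decide_eq_true_eq, Set.ofPred_mem_eq]
        omega
  obtain ⟨σ, hσ, hun⟩ := exists_unmergeable h.exists_cycle_factor
  have h' : D.IsUnmergeableFactor _ a σ := ⟨h, hσ, fun x u hxu h1 h2 => hun x u hxu ⟨h1, h2⟩⟩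
  have : Nonempty V := (Nat.card_pos_iff.1 (by omega)).1
  obtain ⟨x⟩ := this
  refine isHamiltonian_of_sameCycle hσ x (fun e => ?_) (h'.sameCycle x)
  have := h'.color_apply x
  rw [e] at this
  simp at this

end Digraph

/-! ### Sharpness examples -/

namespace Digraph

open Equiv Equiv.Perm

section Criteria

/-- Makes strongness decidable by evaluation: `f` walks forwards along arcs to the root `r`, and `g`
walks backwards to it. -/
theorem isStrong_of_iterate {V : Type*} {D : Digraph V} (r : V) (k : ℕ) (f g : V → V) (hf : ∀ v, f v = v ∨ D.Adj v (f v))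
    (hg : ∀ v, g v = v ∨ D.Adj (g v) v) (hfk : ∀ v, f^[k] v = r) (hgk : ∀ v, g^[k] v = r) :
    D.IsStrong := by
  have hout : ∀ n v, Relation.ReflTransGen D.Adj v (f^[n] v) := by
    intro n
    induction n with
    | zero => exact fun v => .refl
    | succ n ih =>
      intro v
      rw [Function.iterate_succ_apply]
      rcases hf v with h | h
      · rw [h]; exact ih v
      · exact .head h (ih _)
  have hin : ∀ n v, Relation.ReflTransGen D.Adj (g^[n] v) v := by
    intro n
    induction n with
    | zero => exact fun v => .refl
    | succ n ih =>
      intro v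
      rw [Function.iterate_succ_apply]
      rcases hg v with h | h
      · rw [h]; exact ih v
      · exact .tail (ih _) h
  intro x y
  have h1 := hout k x
  have h2 := hin k y
  rw [hfk] at h1
  rw [hgk] at h2
  exact h1.trans h2

variable {V : Type*} [Fintype V] {D : Digraph V}

theorem isBalancedBipartite_of_color (f : V → Bool) (hf : ∀ u v, D.Adj u v → f u ≠ f v)
    (hcard : (Finset.univ.filter (f · = true)).card = (Finset.univ.filter (f · = false)).card) :
    D.IsBalancedBipartite := by
  refine ⟨{v | f v = true}, {v | f v = false}, ?_, ?_, ?_, ?_, ?_⟩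
  · exact Set.disjoint_left.2 fun v (h1 : f v = true) (h2 : f v = false) => by simp [h1] at h2
  · ext v
    cases hv : f v <;> simp [hv]
  · exact fun u hu v hv huv => hf u v huv (Eq.trans hu (Eq.symm hv))
  · exact fun u hu v hv huv => hf u v huv (Eq.trans hu (Eq.symm hv))
  · simpa [Set.ncard_eq_toFinset_card'] using hcard

theorem deg_eq_card [DecidableRel D.Adj] (v : V) :
    D.deg v = (Finset.univ.filter (D.Adj v)).card +
      (Finset.univ.filter (D.Adj · v)).card := by
  simp [deg, outDeg, inDeg, Set.ncard_eq_toFinset_card']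

theorem dominatingPairDegrees_of_card [DecidableRel D.Adj] {p q : ℕ} (d : V → ℕ)
    (hd : ∀ v, (Finset.univ.filter (D.Adj v)).card + (Finset.univ.filter (D.Adj · v)).card = d v)
    (h : ∀ x y z, x ≠ y → D.Adj x z → D.Adj y z → (p ≤ d x ∧ q ≤ d y) ∨ (p ≤ d y ∧ q ≤ d x)) :
    D.DominatingPairDegrees p q := by
  rintro x y ⟨hne, z, hx, hy⟩
  rw [deg_eq_card, deg_eq_card, hd, hd]
  exact h x y z hne hx hy

theorem eq_or_eq_of_two_cycle {σ : Perm V} {v w : V} (hv : σ (σ v) = v)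
    (hw : σ.SameCycle v w) : w = v ∨ w = σ v :=
  sameCycle_induction (P := fun w => w = v ∨ w = σ v)
    (by rintro w (rfl | rfl) <;> simp [hv]) (Or.inl rfl) hw

end Criteria

/-- The bidirected path on four vertices. -/
def bidirectedPath : Digraph (Fin 4) where
  Adj u v := u.val + 1 = v.val ∨ v.val + 1 = u.val

instance : DecidableRel bidirectedPath.Adj :=
  fun u v => inferInstanceAs (Decidable (u.val + 1 = v.val ∨ v.val + 1 = u.val))

theorem bidirectedPath_isBalancedBipartite : bidirectedPath.IsBalancedBipartite :=
  isBalancedBipartite_of_color ![true, false, true, false] (by decide) (by decide)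

theorem bidirectedPath_isStrong : bidirectedPath.IsStrong :=
  isStrong_of_iterate 0 3 ![0, 0, 1, 2] ![0, 0, 1, 2] (by decide) (by decide) (by decide)
    (by decide)

theorem bidirectedPath_dominatingPairDegrees : bidirectedPath.DominatingPairDegrees 3 2 :=
  dominatingPairDegrees_of_card ![2, 4, 4, 2] (by decide) (by decide)

theorem bidirectedPath_not_isHamiltonian : ¬ bidirectedPath.IsHamiltonian := by
  intro h
  obtain ⟨σ, hσ, hs⟩ := h.exists_perm
  have h0 : σ 0 = 1 := (by decide : ∀ w, bidirectedPath.Adj 0 w → w = 1) _ (hσ 0)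
  have h1 : σ.symm 0 = 1 := (by decide : ∀ w, bidirectedPath.Adj w 0 → w = 1) _
    (by simpa using hσ (σ.symm 0))
  have h2 : σ (σ 0) = 0 := by rw [h0, ← h1]; simp
  have := eq_or_eq_of_two_cycle h2 (hs 0 2)
  rw [h0] at this
  revert this
  decide

/-- The vertices `0` and `1` have a single out-neighbour, the same one. -/
def commonSink : Digraph (Fin 6) where
  Adj u v := v ∈ (![[3], [3], [4, 5], [0, 1, 2], [0, 1, 2], [0, 1, 2]] : Fin 6 → List (Fin 6)) u

instance : DecidableRel commonSink.Adj := fun u v => inferInstanceAs (Decidable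
  (v ∈ (![[3], [3], [4, 5], [0, 1, 2], [0, 1, 2], [0, 1, 2]] : Fin 6 → List (Fin 6)) u))

theorem commonSink_isBalancedBipartite : commonSink.IsBalancedBipartite :=
  isBalancedBipartite_of_color ![true, true, true, false, false, false] (by decide) (by decide)

theorem commonSink_isStrong : commonSink.IsStrong :=
  isStrong_of_iterate 0 4 ![0, 3, 4, 0, 0, 0] ![0, 3, 3, 0, 2, 2] (by decide) (by decide)
    (by decide) (by decide)

theorem commonSink_dominatingPairDegrees : commonSink.DominatingPairDegrees 4 4 :=
  dominatingPairDegrees_of_card ![4, 4, 5, 5, 4, 4] (by decide) (by decide)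

theorem commonSink_not_isHamiltonian : ¬ commonSink.IsHamiltonian := by
  intro h
  obtain ⟨σ, hσ, -⟩ := h.exists_perm
  have h0 : σ 0 = 3 := (by decide : ∀ w, commonSink.Adj 0 w → w = 3) _ (hσ 0)
  have h1 : σ 1 = 3 := (by decide : ∀ w, commonSink.Adj 1 w → w = 3) _ (hσ 1)
  exact absurd (σ.injective (h0.trans h1.symm)) (by decide)

/-- The arcs from `{0, 1, 2}` to `{3, 4, 5}` contain only one perfect matching, and it does not
extend to a directed cycle through all vertices. -/
def forcedMatching : Digraph (Fin 6) where
  Adj u v := v ∈ (![[3, 4, 5], [4, 5], [4], [0, 1], [1, 2], [0, 1, 2]] : Fin 6 → List (Fin 6)) u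

instance : DecidableRel forcedMatching.Adj := fun u v => inferInstanceAs (Decidable
  (v ∈ (![[3, 4, 5], [4, 5], [4], [0, 1], [1, 2], [0, 1, 2]] : Fin 6 → List (Fin 6)) u))

theorem forcedMatching_isBalancedBipartite : forcedMatching.IsBalancedBipartite :=
  isBalancedBipartite_of_color ![true, true, true, false, false, false] (by decide) (by decide)

theorem forcedMatching_isStrong : forcedMatching.IsStrong :=
  isStrong_of_iterate 0 4 ![0, 5, 4, 0, 1, 0] ![0, 4, 4, 0, 0, 0] (by decide) (by decide)
    (by decide) (by decide)

theorem forcedMatching_dominatingPairDegrees : forcedMatching.DominatingPairDegrees 5 3 :=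
  dominatingPairDegrees_of_card ![5, 5, 3, 3, 5, 5] (by decide) (by decide)

theorem forcedMatching_not_isHamiltonian : ¬ forcedMatching.IsHamiltonian := by
  intro h
  obtain ⟨σ, hσ, hs⟩ := h.exists_perm
  have inj : ∀ {u v w z}, σ u = w → σ v = z → u ≠ v → w ≠ z :=
    fun hu hv huv e => huv (σ.injective (hu.trans (e.trans hv.symm)))
  -- Vertex `1` lies outside both 2-cycles to be ruled out, `{0, 3}` and `{2, 4}`.
  have no_two : ∀ {u v}, σ u = v → σ v = u → (1 : Fin 6) = u ∨ 1 = v := by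
    rintro u v rfl hv
    exact eq_or_eq_of_two_cycle hv (hs u 1)
  have h2 : σ 2 = 4 := (by decide : ∀ w, forcedMatching.Adj 2 w → w = 4) _ (hσ 2)
  have h1 : σ 1 = 5 := (by decide : ∀ w, forcedMatching.Adj 1 w → w ≠ 4 → w = 5) _ (hσ 1)
    (inj rfl h2 (by decide))
  have h0 : σ 0 = 3 := (by decide : ∀ w, forcedMatching.Adj 0 w → w ≠ 4 → w ≠ 5 → w = 3) _ (hσ 0)
    (inj rfl h2 (by decide)) (inj rfl h1 (by decide))
  have h3 : σ 3 = 1 := (by decide : ∀ w, forcedMatching.Adj 3 w → w ≠ 0 → w = 1) _ (hσ 3)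
    (fun e => absurd (no_two h0 e) (by decide))
  have h4 : σ 4 = 2 := (by decide : ∀ w, forcedMatching.Adj 4 w → w ≠ 1 → w = 2) _ (hσ 4)
    (inj rfl h3 (by decide))
  exact absurd (no_two h2 h4) (by decide)

end Digraph

theorem theorem1p6 :
    -- the sufficient condition
    (∀ (V : Type*) (D : Digraph V) (a : ℕ), 2 ≤ a → Nat.card V = 2 * a →
      D.IsBalancedBipartite → D.IsStrong → D.ConditionB a 1 → D.IsHamiltonian) ∧
    -- sharpness: for `a = 2, 3`, neither of the bounds `2a - 1` and `a + 1` can be lowered by one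
    (∀ a : ℕ, a = 2 ∨ a = 3 →
      (∃ (V : Type) (D : Digraph V), Nat.card V = 2 * a ∧
        D.IsBalancedBipartite ∧ D.IsStrong ∧
        D.DominatingPairDegrees (2 * a - 2) (a + 1) ∧ ¬ D.IsHamiltonian) ∧
      (∃ (V : Type) (D : Digraph V), Nat.card V = 2 * a ∧
        D.IsBalancedBipartite ∧ D.IsStrong ∧
        D.DominatingPairDegrees (2 * a - 1) a ∧ ¬ D.IsHamiltonian)) := by
  refine ⟨fun V D a ha hcard hbip hstr hB =>
    Digraph.isHamiltonian_of_conditionB ha hcard hbip hstr hB, ?_⟩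
  rintro a (rfl | rfl)
  -- For `a = 2` the two relaxed conditions have the same pair of bounds, `(2, 3)` and `(3, 2)`, so
  -- one digraph serves for both.
  · have h := Digraph.bidirectedPath_dominatingPairDegrees
    exact ⟨⟨_, Digraph.bidirectedPath, by simp, Digraph.bidirectedPath_isBalancedBipartite,
      Digraph.bidirectedPath_isStrong, fun x y hxy => (h x y hxy).symm.imp And.symm And.symm,
      Digraph.bidirectedPath_not_isHamiltonian⟩,
      ⟨_, Digraph.bidirectedPath, by simp, Digraph.bidirectedPath_isBalancedBipartite,
      Digraph.bidirectedPath_isStrong, h, Digraph.bidirectedPath_not_isHamiltonian⟩⟩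
  · exact ⟨⟨_, Digraph.commonSink, by simp, Digraph.commonSink_isBalancedBipartite,
      Digraph.commonSink_isStrong, Digraph.commonSink_dominatingPairDegrees,
      Digraph.commonSink_not_isHamiltonian⟩,
      ⟨_, Digraph.forcedMatching, by simp, Digraph.forcedMatching_isBalancedBipartite,
      Digraph.forcedMatching_isStrong, Digraph.forcedMatching_dominatingPairDegrees,
      Digraph.forcedMatching_not_isHamiltonian⟩⟩
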